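/- Let $k,m$ be positive integers, let $\mathbb{F}_q$ be a finite field, and call any $\mathbb{F}_q$-linear subspace $\mathcal{C}\subseteq \mathrm{Mat}(k\times m,\mathbb{F}_q)$ a code. Write $\mathrm{maxrk}(\mathcal{C})=\max\{\mathrm{rk}(M): M\in\mathcal{C}\}$ and, for $\mathcal{C}\neq\{0\}$, $\mathrm{minrk}(\mathcal{C})=\min\{\mathrm{rk}(M): M\in\mathcal{C},\ \mathrm{rk}(M)>0\}$. A non-zero code $\mathcal{C}$ is called MRD if $\dim_{\mathbb{F}_q}(\mathcal{C})=\max\{k,m\}\,(\min\{k,m\}-\mathrm{minrk}(\mathcal{C})+1)$ (the zero code is also considered MRD), and a code $\mathcal{C}$ is called an optimal anticode if $\dim_{\mathbb{F}_q}(\mathcal{C})=\max\{k,m\}\cdot\mathrm{maxrk}(\mathcal{C})$. Let $0\le D\le \min\{k,m\}-1$ be an integer, and let $\mathcal{C}\subseteq \mathrm{Mat}(k\times m,\mathbb{F}_q)$ be an $\mathbb{F}_q$-subspace with $\dim_{\mathbb{F}_q}(\mathcal{C})=\max\{k,m\}\cdot D$. The following are equivalent: 1. $\mathcal{C}$ is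 an optimal anticode. 2. $\mathcal{C}\cap\mathcal{D}=\{0\}$ for all non-zero MRD codes $\mathcal{D}\subseteq \mathrm{Mat}(k\times m,\mathbb{F}_q)$ with $\mathrm{minrk}(\mathcal{D})=D+1$. -/

import Mathlib

namespace RankMetric

variable {F : Type*} [Field F] {k m : ℕ}

/-- A (Delsarte rank-metric) code of size `k × m` over `F`: an `F`-linear subspace of the
space of `k × m` matrices. -/
abbrev Code (F : Type*) [Field F] (k m : ℕ) : Type _ :=
  Submodule F (Matrix (Fin k) (Fin m) F)

/-- The minimum rank of a non-zero code: the least positive rank of a matrix of the code.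
(For the zero code the set is empty and the value is the irrelevant default `0`.) -/
noncomputable def minrk (C : Code F k m) : ℕ :=
  sInf {r : ℕ | ∃ M ∈ C, M.rank = r ∧ 0 < M.rank}

/-- The maximum rank of a code: the largest rank of a matrix of the code. The set of ranks
contains `0` and is bounded above by `min k m`, so the supremum is attained. -/
noncomputable def maxrk (C : Code F k m) : ℕ :=
  sSup {r : ℕ | ∃ M ∈ C, M.rank = r}

/-- MRD codes: the zero code, and the non-zero codes whose dimension attains the bound
`dim C ≤ max k m * (min k m - minrk C + 1)`. For a non-zero code `minrk C ≤ min k m`,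
so the subtraction is the ordinary one. -/
def IsMRD (C : Code F k m) : Prop :=
  C = ⊥ ∨ Module.finrank F C = max k m * (min k m - minrk C + 1)

/-- Optimal anticodes: codes whose dimension attains the bound
`dim C ≤ max k m * maxrk C`. -/
def IsOptimalAnticode (C : Code F k m) : Prop :=
  Module.finrank F C = max k m * maxrk C

end RankMetric

/-! A code of maximum rank `D` meets a code of minimum rank `D + 1` only in zero, which is one
direction. Conversely, if `C` had a matrix `M` of rank above `D`, some MRD code of minimum rank `D +
1` would contain `M`; so `maxrk C ≤ D`, and the anticode bound gives equality. That MRD code is a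
twisted Gabidulin code. Linearized polynomials with `K` coefficients have kernels of dimension below
`K`, and every such subspace occurs as a kernel. Hence some codeword has the kernel of `M`; it
differs from `M` by an automorphism of the target, and applying this automorphism to the whole code
preserves all ranks. -/

open Module Polynomial

/-! ### Linearized polynomials and their kernels. -/

namespace FiniteField

variable (F L : Type*) [Field F] [Fintype F] [Field L] [Algebra F L]

/-- The `L`-linear map sending a polynomial `∑ aᵢ Xⁱ` over `L` to the `F`-linear endomorphism
`x ↦ ∑ aᵢ x ^ (qⁱ)` of `L`, where `q` is the cardinality of `F`. -/
noncomputable def linearizedMap : L[X] →ₗ[L] (L →ₗ[F] L) :=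
  Polynomial.lsum fun i =>
    LinearMap.toSpanSingleton L (L →ₗ[F] L) ((frobeniusAlgHom F L ^ i).toLinearMap)

variable {F L}

theorem linearizedMap_apply {n : ℕ} {p : L[X]} (hp : p ∈ degreeLT L n) (x : L) :
    linearizedMap F L p x = ∑ i ∈ Finset.range n, p.coeff i * x ^ Fintype.card F ^ i := by
  have h : p.natDegree < n ∨ p = 0 := by
    by_cases h0 : p = 0
    · exact Or.inr h0
    · exact Or.inl ((natDegree_lt_iff_degree_lt h0).2 (mem_degreeLT.1 hp))
  rcases h with h | rfl
  · rw [linearizedMap, lsum_apply, sum_over_range' _ (by simp) n h]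
    simp [LinearMap.sum_apply, AlgHom.coe_pow, coe_frobeniusAlgHom, pow_iterate]
  · simp

/-- The kernel consists of roots of a nonzero polynomial of degree at most `q ^ (n - 1)`, and it has
`q ^ dim` elements. -/
theorem finrank_ker_linearizedMap_lt [FiniteDimensional F L] {n : ℕ} {p : L[X]}
    (hp : p ∈ degreeLT L n) (h0 : p ≠ 0) :
    finrank F (LinearMap.ker (linearizedMap F L p)) < n := by
  classical
  have hq : 1 < Fintype.card F := Fintype.one_lt_card
  have hdeg : p.natDegree < n := (natDegree_lt_iff_degree_lt h0).2 (mem_degreeLT.1 hp)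
  let P : L[X] := ∑ i ∈ Finset.range n, C (p.coeff i) * X ^ Fintype.card F ^ i
  have hP : P ≠ 0 := by
    intro h
    -- The exponents `q ^ i` are distinct, so no coefficients merge.
    have hc : P.coeff (Fintype.card F ^ p.natDegree) = p.leadingCoeff := by
      simp only [P, finsetSum_coeff, coeff_C_mul, coeff_X_pow,
        (Nat.pow_right_injective hq).eq_iff]
      simp [hdeg]
    rw [h, coeff_zero] at hc
    exact h0 (leadingCoeff_eq_zero.1 hc.symm)
  have hPd : P.natDegree ≤ Fintype.card F ^ (n - 1) := by
    refine natDegree_sum_le_of_forall_le _ _ fun i hi => ?_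
    refine (natDegree_C_mul_X_pow_le _ _).trans (Nat.pow_le_pow_right hq.le ?_)
    have := Finset.mem_range.1 hi
    omega
  have : Finite L := Module.finite_of_finite F
  have := Fintype.ofFinite (LinearMap.ker (linearizedMap F L p))
  have hcard : Fintype.card (LinearMap.ker (linearizedMap F L p)) ≤ P.natDegree := by
    have hs : (Finset.univ.map (Function.Embedding.subtype
        (· ∈ LinearMap.ker (linearizedMap F L p)))).val ⊆ P.roots := by
      intro x hx
      have hx' : linearizedMap F L p x = 0 := by simpa using hx
      rw [mem_roots hP, IsRoot.def, eval_finsetSum, ← hx', linearizedMap_apply hp]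
      simp
    simpa using card_le_degree_of_subset_roots hs
  rw [← Nat.card_eq_fintype_card, Module.natCard_eq_pow_finrank (K := F),
    Nat.card_eq_fintype_card] at hcard
  have := (Nat.pow_le_pow_iff_right hq).1 (hcard.trans hPd)
  omega

theorem finrank_degreeLT (L : Type*) [Field L] (n : ℕ) : finrank L (degreeLT L n) = n := by
  rw [(degreeLTEquiv L n).finrank_eq, finrank_fin_fun]

/-- These are `n` linear conditions on `n + 1` coefficients. -/
theorem exists_linearizedMap_apply_eq_zero {n : ℕ} (b : Fin n → L) :
    ∃ p ∈ degreeLT L (n + 1), p ≠ 0 ∧ ∀ i, linearizedMap F L p (b i) = 0 := by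
  let ev (x : L) : (L →ₗ[F] L) →ₗ[L] L :=
    { toFun := fun f => f x, map_add' := fun _ _ => rfl, map_smul' := fun _ _ => rfl }
  let T : degreeLT L (n + 1) →ₗ[L] (Fin n → L) :=
    LinearMap.pi fun i => ev (b i) ∘ₗ linearizedMap F L ∘ₗ (degreeLT L _).subtype
  have : FiniteDimensional L (degreeLT L (n + 1)) := (degreeLTEquiv L _).symm.finiteDimensional
  have hT : LinearMap.ker T ≠ ⊥ :=
    LinearMap.ker_ne_bot_of_finrank_lt (by rw [finrank_degreeLT, finrank_fin_fun]; omega)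
  obtain ⟨p, hpT, hp0⟩ := Submodule.exists_mem_ne_zero_of_ne_bot hT
  exact ⟨p, p.2, fun h => hp0 (Subtype.ext h), fun i => congrFun (LinearMap.mem_ker.1 hpT) i⟩

/-- Every `F`-subspace of `L` is the kernel of a linearized polynomial of the least possible
degree. -/
theorem exists_ker_linearizedMap_eq [FiniteDimensional F L] (N : Submodule F L) :
    ∃ p ∈ degreeLT L (finrank F N + 1), LinearMap.ker (linearizedMap F L p) = N := by
  let b := finBasis F N
  obtain ⟨p, hp, hp0, hpb⟩ := exists_linearizedMap_apply_eq_zero (F := F) fun i => (b i : L)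
  have hz : (linearizedMap F L p).domRestrict N = 0 := b.ext hpb
  have hle : N ≤ LinearMap.ker (linearizedMap F L p) := fun x hx =>
    LinearMap.congr_fun hz ⟨x, hx⟩
  exact ⟨p, hp, (Submodule.eq_of_le_of_finrank_le hle
    (Nat.lt_succ_iff.1 (finrank_ker_linearizedMap_lt hp hp0))).symm⟩

end FiniteField

/-! ### Gabidulin codes through a prescribed map. -/

namespace LinearMap

variable {F V W : Type*} [Field F] [AddCommGroup V] [Module F V] [AddCommGroup W] [Module F W]

/-- Both ranges are isomorphic to the quotient by the common kernel; this isomorphism of ranges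
extends to `W`. -/
theorem exists_linearEquiv_comp_eq_of_ker_eq [FiniteDimensional F W] {f g : V →ₗ[F] W}
    (h : ker f = ker g) : ∃ B : W ≃ₗ[F] W, B.toLinearMap ∘ₗ f = g := by
  obtain ⟨B, hB⟩ := Submodule.exists_linearEquiv_restrict_eq
    (f.quotKerEquivRange.symm ≪≫ₗ Submodule.quotEquivOfEq _ _ h ≪≫ₗ g.quotKerEquivRange)
  refine ⟨B, ext fun x => ?_⟩
  have := hB ⟨f x, mem_range_self f x⟩
  have hx : f.quotKerEquivRange.symm ⟨f x, mem_range_self f x⟩ = Submodule.Quotient.mk x := by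
    rw [LinearEquiv.symm_apply_eq]
    rfl
  simp only [LinearEquiv.trans_apply, hx] at this
  exact this.symm

theorem finrank_range_linearEquiv_comp {W' : Type*} [AddCommGroup W'] [Module F W']
    (e : W ≃ₗ[F] W') (f : V →ₗ[F] W) :
    finrank F (range (e.toLinearMap ∘ₗ f)) = finrank F (range f) := by
  rw [range_comp]
  exact LinearEquiv.finrank_map_eq e _

theorem exists_submodule_finrank_range_gt_of_algebra {L : Type*} [Finite F] [Field L]
    [Algebra F L] [FiniteDimensional F V] [FiniteDimensional F L]
    (hVL : finrank F V ≤ finrank F L) {D : ℕ} (hD : D < finrank F V)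
    (g : V →ₗ[F] L) (hg : D < finrank F (range g)) :
    ∃ E : Submodule F (V →ₗ[F] L), finrank F E = finrank F L * (finrank F V - D) ∧
      (∀ f ∈ E, f ≠ 0 → D < finrank F (range f)) ∧
      (∃ f ∈ E, finrank F (range f) = D + 1) ∧ g ∈ E := by
  have := Fintype.ofFinite F
  obtain ⟨ι, hι⟩ := finrank_le_iff_exists_linearMap.1 hVL
  set K := finrank F V - D with hK
  have hker (N : Submodule F V) (hN : finrank F N < K) :
      ∃ p ∈ degreeLT L K, ker (FiniteField.linearizedMap F L p ∘ₗ ι) = N := by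
    obtain ⟨p, hp, hpN⟩ := FiniteField.exists_ker_linearizedMap_eq (N.map ι)
    rw [LinearEquiv.finrank_eq (N.equivMapOfInjective ι hι).symm] at hp
    refine ⟨p, degreeLT_mono hN hp, ?_⟩
    rw [ker_comp, hpN, Submodule.comap_map_eq_of_injective hι]
  have hrange (p : L[X]) (hp : p ∈ degreeLT L K) (h0 : p ≠ 0) :
      D < finrank F (range (FiniteField.linearizedMap F L p ∘ₗ ι)) := by
    have h1 := finrank_range_add_finrank_ker (FiniteField.linearizedMap F L p ∘ₗ ι)
    have h2 := FiniteField.finrank_ker_linearizedMap_lt (F := F) hp h0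
    have h3 : finrank F (ker (FiniteField.linearizedMap F L p ∘ₗ ι)) ≤
        finrank F (ker (FiniteField.linearizedMap F L p)) := by
      refine (LinearEquiv.finrank_eq (Submodule.equivMapOfInjective ι hι _)).trans_le
        (Submodule.finrank_mono ?_)
      rw [ker_comp]
      exact Submodule.map_comap_le _ _
    omega
  have hgr := finrank_range_add_finrank_ker g
  obtain ⟨p, hp, hpg⟩ := hker (ker g) (by omega)
  obtain ⟨B, hB⟩ := exists_linearEquiv_comp_eq_of_ker_eq hpg
  -- Only `F`-linear, since the twist `B` need not be `L`-linear.
  let T : degreeLT L K →ₗ[F] (V →ₗ[F] L) :=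
    (compRight F B.toLinearMap) ∘ₗ (lcomp F L ι) ∘ₗ
      ((FiniteField.linearizedMap F L).comp (degreeLT L K).subtype).restrictScalars F
  have hT (p : degreeLT L K) :
      T p = B.toLinearMap ∘ₗ (FiniteField.linearizedMap F L p ∘ₗ ι) := rfl
  have hT0 (p : degreeLT L K) (h0 : p ≠ 0) : D < finrank F (range (T p)) := by
    rw [hT, finrank_range_linearEquiv_comp]
    exact hrange p p.2 fun h => h0 (Subtype.ext h)
  have hTi : Function.Injective T := by
    refine ker_eq_bot.1 ((Submodule.eq_bot_iff _).2 fun p hp => ?_)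
    by_contra h0
    have := hT0 p h0
    rw [mem_ker.1 hp, range_zero, finrank_bot] at this
    omega
  refine ⟨range T, ?_, ?_, ?_, ⟨⟨p, hp⟩, hB⟩⟩
  · rw [finrank_range_of_inj hTi, ← finrank_mul_finrank F L, FiniteField.finrank_degreeLT]
  · rintro _ ⟨p, rfl⟩ h0
    exact hT0 p fun h => h0 (by rw [h, map_zero])
  -- A codeword whose kernel has the largest allowed dimension, `K - 1`, has rank `D + 1`.
  · obtain ⟨j, hj⟩ := (finrank_le_iff_exists_linearMap (R := F) (M := Fin (K - 1) → F)
      (M' := V)).1 (by rw [finrank_fin_fun]; omega)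
    have hjr : finrank F (range j) = K - 1 := by rw [finrank_range_of_inj hj, finrank_fin_fun]
    obtain ⟨p, hp, hpj⟩ := hker (range j) (by omega)
    refine ⟨T ⟨p, hp⟩, mem_range_self _ _, ?_⟩
    have := finrank_range_add_finrank_ker (FiniteField.linearizedMap F L p ∘ₗ ι)
    rw [hpj, hjr] at this
    rw [hT, finrank_range_linearEquiv_comp]
    dsimp only
    omega

/-- Gabidulin codes: over a finite field there are spaces of linear maps attaining the Singleton
bound, and such a space can be chosen to contain any given map of sufficiently large rank. -/
theorem exists_submodule_finrank_range_gt [Finite F] [FiniteDimensional F V]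
    [FiniteDimensional F W] (hVW : finrank F V ≤ finrank F W) {D : ℕ} (hD : D < finrank F V)
    (g : V →ₗ[F] W) (hg : D < finrank F (range g)) :
    ∃ E : Submodule F (V →ₗ[F] W), finrank F E = finrank F W * (finrank F V - D) ∧
      (∀ f ∈ E, f ≠ 0 → D < finrank F (range f)) ∧
      (∃ f ∈ E, finrank F (range f) = D + 1) ∧ g ∈ E := by
  obtain ⟨p, hp⟩ := CharP.exists F
  have : Fact p.Prime := ⟨CharP.char_is_prime F p⟩
  have : NeZero (finrank F W) := ⟨by omega⟩
  have hL := FiniteField.finrank_extension F p (finrank F W)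
  let e : FiniteField.Extension F p (finrank F W) ≃ₗ[F] W := LinearEquiv.ofFinrankEq _ _ hL
  obtain ⟨E, hE, hmin, ⟨f, hf, hfr⟩, hgE⟩ := exists_submodule_finrank_range_gt_of_algebra
    (hVW.trans hL.ge) hD (e.symm.toLinearMap ∘ₗ g)
    (by rwa [finrank_range_linearEquiv_comp])
  let c := LinearEquiv.congrRight (M := V) e
  have hcr (f) : finrank F (range (c f)) = finrank F (range f) :=
    finrank_range_linearEquiv_comp e f
  refine ⟨E.map c.toLinearMap, ?_, ?_, ⟨c f, ⟨f, hf, rfl⟩, by rw [hcr, hfr]⟩, ⟨_, hgE, ?_⟩⟩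
  · rw [LinearEquiv.finrank_map_eq, hE, hL]
  · rintro _ ⟨f, hf, rfl⟩ h0
    refine (hmin f hf fun h => h0 (by rw [h, map_zero])).trans_eq (hcr f).symm
  · ext x
    exact e.apply_symm_apply (g x)

end LinearMap

/-! ### Matrix codes and the anticode bound. -/

namespace RankMetric

variable {F : Type*} [Field F] {k m : ℕ}

theorem rank_eq_finrank_range_toLin' (M : Matrix (Fin k) (Fin m) F) :
    M.rank = finrank F (LinearMap.range M.toLin') := rfl

theorem rank_eq_zero_iff {M : Matrix (Fin k) (Fin m) F} : M.rank = 0 ↔ M = 0 := by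
  rw [rank_eq_finrank_range_toLin', Submodule.finrank_eq_zero, LinearMap.range_eq_bot,
    LinearEquiv.map_eq_zero_iff]

theorem rank_le_min (M : Matrix (Fin k) (Fin m) F) : M.rank ≤ min k m :=
  le_min M.rank_le_height M.rank_le_width

theorem rank_le_maxrk {C : Code F k m} {M : Matrix (Fin k) (Fin m) F} (hM : M ∈ C) :
    M.rank ≤ maxrk C := by
  refine le_csSup ⟨min k m, ?_⟩ ⟨M, hM, rfl⟩
  rintro _ ⟨N, -, rfl⟩
  exact rank_le_min N

theorem maxrk_le_iff {C : Code F k m} {D : ℕ} : maxrk C ≤ D ↔ ∀ M ∈ C, M.rank ≤ D := by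
  refine ⟨fun h M hM => (rank_le_maxrk hM).trans h, fun h => csSup_le ⟨_, 0, C.zero_mem, rfl⟩ ?_⟩
  rintro _ ⟨M, hM, rfl⟩
  exact h M hM

theorem minrk_le_rank {C : Code F k m} {M : Matrix (Fin k) (Fin m) F} (hM : M ∈ C) (h0 : M ≠ 0) :
    minrk C ≤ M.rank :=
  Nat.sInf_le ⟨M, hM, rfl, Nat.pos_of_ne_zero (rank_eq_zero_iff.not.2 h0)⟩

theorem minrk_eq {C : Code F k m} {d : ℕ} (hd : 0 < d) (hC : ∀ M ∈ C, M ≠ 0 → d ≤ M.rank)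
    (hM : ∃ M ∈ C, M.rank = d) : minrk C = d := by
  obtain ⟨M, hM, rfl⟩ := hM
  refine le_antisymm (Nat.sInf_le ⟨M, hM, rfl, hd⟩) (le_csInf ⟨_, M, hM, rfl, hd⟩ ?_)
  rintro _ ⟨N, hN, rfl, hpos⟩
  exact hC N hN (rank_eq_zero_iff.not.1 hpos.ne')

theorem exists_code_of_le [Finite F] (h : m ≤ k) {D : ℕ} (hD : D < m)
    (M : Matrix (Fin k) (Fin m) F) (hM : D < M.rank) :
    ∃ E : Code F k m, finrank F E = k * (m - D) ∧ (∀ N ∈ E, N ≠ 0 → D < N.rank) ∧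
      (∃ N ∈ E, N.rank = D + 1) ∧ M ∈ E := by
  obtain ⟨E, hE, hmin, ⟨f, hf, hfr⟩, hME⟩ := LinearMap.exists_submodule_finrank_range_gt
    (V := Fin m → F) (W := Fin k → F) (by simpa) (by simpa) M.toLin' hM
  refine ⟨E.map Matrix.toLin'.symm.toLinearMap, ?_, ?_,
    ⟨LinearMap.toMatrix' f, ⟨f, hf, rfl⟩, ?_⟩, ⟨_, hME, Matrix.toLin'.symm_apply_apply M⟩⟩
  · rw [LinearEquiv.finrank_map_eq, hE, finrank_fin_fun, finrank_fin_fun]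
  · rintro _ ⟨f, hf, rfl⟩ h0
    refine (hmin f hf fun h => h0 (by rw [h, map_zero])).trans_eq ?_
    rw [rank_eq_finrank_range_toLin']
    exact congrArg (fun g => finrank F (LinearMap.range g)) (Matrix.toLin'.apply_symm_apply f).symm
  · rw [rank_eq_finrank_range_toLin', Matrix.toLin'_toMatrix', hfr]

theorem exists_code [Finite F] {D : ℕ} (hD : D < min k m)
    (M : Matrix (Fin k) (Fin m) F) (hM : D < M.rank) :
    ∃ E : Code F k m, finrank F E = max k m * (min k m - D) ∧ (∀ N ∈ E, N ≠ 0 → D < N.rank) ∧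
      (∃ N ∈ E, N.rank = D + 1) ∧ M ∈ E := by
  rcases le_total m k with h | h
  · rw [max_eq_left h, min_eq_right h] at *
    exact exists_code_of_le h hD M hM
  · rw [max_eq_right h, min_eq_left h] at *
    obtain ⟨E, hE, hmin, ⟨N, hN, hNr⟩, hME⟩ :=
      exists_code_of_le h hD M.transpose (by rwa [Matrix.rank_transpose])
    let t := Matrix.transposeLinearEquiv (Fin m) (Fin k) F F
    refine ⟨E.map t.toLinearMap, by rw [LinearEquiv.finrank_map_eq, hE], ?_,
      ⟨t N, ⟨N, hN, rfl⟩, (Matrix.rank_transpose N).trans hNr⟩, ⟨_, hME, rfl⟩⟩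
    rintro _ ⟨N, hN, rfl⟩ h0
    exact (hmin N hN fun h => h0 (by rw [h, map_zero])).trans_eq (Matrix.rank_transpose N).symm

/-- Every matrix of rank at least `D + 1` lies in a non-zero MRD code of minimum rank `D + 1`. -/
theorem exists_isMRD [Finite F] {D : ℕ} (hD : D < min k m)
    (M : Matrix (Fin k) (Fin m) F) (hM : D < M.rank) :
    ∃ E : Code F k m, E ≠ ⊥ ∧ IsMRD E ∧ minrk E = D + 1 ∧ M ∈ E := by
  obtain ⟨E, hE, hmin, hex, hME⟩ := exists_code hD M hM
  have hrk : minrk E = D + 1 := minrk_eq D.succ_pos hmin hex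
  refine ⟨E, ?_, Or.inr ?_, hrk, hME⟩
  · rintro rfl
    rw [(Submodule.mem_bot F).1 hME, Matrix.rank_zero] at hM
    omega
  · rw [hE, hrk]
    congr 1
    omega

theorem exists_rank_eq_min (F : Type*) [Field F] (k m : ℕ) :
    ∃ M : Matrix (Fin k) (Fin m) F, M.rank = min k m := by
  have key {k m : ℕ} (h : m ≤ k) : ∃ M : Matrix (Fin k) (Fin m) F, M.rank = m := by
    obtain ⟨j, hj⟩ := (finrank_le_iff_exists_linearMap (R := F) (M := Fin m → F)
      (M' := Fin k → F)).1 (by simpa)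
    refine ⟨LinearMap.toMatrix' j, ?_⟩
    rw [rank_eq_finrank_range_toLin', Matrix.toLin'_toMatrix', LinearMap.finrank_range_of_inj hj,
      finrank_fin_fun]
  rcases le_total m k with h | h
  · rw [min_eq_right h]
    exact key h
  · obtain ⟨M, hM⟩ := key h
    exact ⟨M.transpose, by rw [Matrix.rank_transpose, hM, min_eq_left h]⟩

/-- The anticode bound. -/
theorem finrank_le_max_mul_maxrk [Finite F] (C : Code F k m) :
    finrank F C ≤ max k m * maxrk C := by
  have htot : finrank F (Matrix (Fin k) (Fin m) F) = max k m * min k m := by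
    rw [finrank_matrix, finrank_self, mul_one, Fintype.card_fin, Fintype.card_fin, max_mul_min]
  rcases lt_or_ge (maxrk C) (min k m) with h | h
  · obtain ⟨M, hM⟩ := exists_rank_eq_min F k m
    -- `E` has minimum rank above `maxrk C`, so it meets `C` trivially and the dimensions add up to
    -- at most that of the whole space. The full-rank `M` only supplies a matrix to prescribe.
    obtain ⟨E, hE, hmin, -, -⟩ := exists_code h M (hM ▸ h)
    have hdisj : Disjoint C E := by
      refine Submodule.disjoint_def.2 fun N hNC hNE => ?_
      by_contra h0
      exact (hmin N hNE h0).not_ge (rank_le_maxrk hNC)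
    have := Submodule.finrank_add_finrank_le_of_disjoint hdisj
    rw [hE, htot, Nat.mul_sub] at this
    have := Nat.mul_le_mul_left (max k m) h.le
    omega
  · exact (Submodule.finrank_le C).trans (htot.trans_le (Nat.mul_le_mul_left _ h))

end RankMetric

theorem proposition5p3 {F : Type*} [Field F] [Finite F] (k m D : ℕ) (hD : D < min k m)
    (C : RankMetric.Code F k m) (hC : Module.finrank F C = max k m * D) :
    RankMetric.IsOptimalAnticode C ↔
      ∀ E : RankMetric.Code F k m, E ≠ ⊥ → RankMetric.IsMRD E → RankMetric.minrk E = D + 1 →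
        C ⊓ E = ⊥ := by
  have hpos : 0 < max k m := by omega
  rw [RankMetric.IsOptimalAnticode, hC]
  constructor
  · intro h E _ _ hrk
    have hmax : D = RankMetric.maxrk C := Nat.eq_of_mul_eq_mul_left hpos h
    refine (Submodule.eq_bot_iff _).2 fun M ⟨hMC, hME⟩ => ?_
    by_contra h0
    have h1 := RankMetric.rank_le_maxrk hMC
    have h2 := RankMetric.minrk_le_rank hME h0
    omega
  · intro h
    have hmax : RankMetric.maxrk C ≤ D := by
      refine RankMetric.maxrk_le_iff.2 fun M hM => ?_
      by_contra! hlt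
      obtain ⟨E, hE0, hE, hrk, hME⟩ := RankMetric.exists_isMRD hD M hlt
      have hMz : M ∈ C ⊓ E := ⟨hM, hME⟩
      rw [h E hE0 hE hrk, Submodule.mem_bot] at hMz
      rw [hMz, Matrix.rank_zero] at hlt
      omega
    refine le_antisymm ?_ (Nat.mul_le_mul_left _ hmax)
    rw [← hC]
    exact RankMetric.finrank_le_max_mul_maxrk C
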